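/- **Setting.** Let $e(x)=e^{2\pi i x}$ and let $L^2(\mathbb Z_N)$ be the space of functions $\mathbb Z_N=\mathbb Z/N\mathbb Z\to\mathbb C$ with $\langle\phi,\psi\rangle=\frac1N\sum_{Q\in\mathbb Z_N}\phi(Q)\overline{\psi(Q)}$ and $\|\psi\|_\infty=\max_Q|\psi(Q)|$. For $N\ge 1$ put $N'=N$ if $N$ is odd and $N'=2N$ if $N$ is even. Let $n_b=\begin{pmatrix}1&b\\0&1\end{pmatrix}$, $a_t=\begin{pmatrix}t&0\\0&t^{-1}\end{pmatrix}$, $\omega=\begin{pmatrix}0&1\\-1&0\end{pmatrix}$. For a prime power $q=p^k$ and an integer $r$ prime to $p$ put $S_r(a,q)=q^{-1/2}\sum_{x\in\mathbb Z_q}e(-rax^2/q')$, $\Lambda(t)=S_r(-t,q)/S_r(-1,q)$, and $$U_q(n_b)\psi(x)=e\Big(\frac{rbx^2}{q'}\Big)\psi(x),\qquad U_q(a_t)\psi(x)=\Lambda(t)\psi(tx),\qquad H\psi(x)=\frac{S_r(-1,q)}{\sqrt q}\sum_{y\in\mathbb Z_q}\psi(y)\,e\Big(\frac{2rxy}{q'}\Big).$$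 If $p$ is odd, $U_q$ is the representation of $SL(2,\mathbb Z_q)$ on $L^2(\mathbb Z_q)$ given on generators by these formulas and $U_q(\omega)=H$ (the Weil representation). If $p=2$, $U_q$ is the representation of $\{g\in SL(2,\mathbb Z_{2q}): g\equiv I \pmod 4\}$ given on the generators $n_b,\ n_c^T,\ a_t$ ($b,c\equiv0$, $t\equiv1 \pmod 4$) by these formulas and $U_q(n_c^T)=H^{-1}U_q(n_{-c})H$. For general $N=\prod_p p^{k_p}$ choose for each $p\mid N$ an integer $r_p$ prime to $p$, and for $g\in SL(2,\mathbb Z_{N'})$ (with $g\equiv I\pmod 4$ if $N$ is even) let $U_N(g)=\bigotimes_p U_{p^{k_p}}(g)$, where $L^2(\mathbb Z_N)\cong\bigotimes_pL^2(\mathbb Z_{p^{k_p}})$ by the Chinese remainder theorem. Let $A\in SL(2,\mathbb Z)$ with $|\operatorname{tr}A|>2$, with odd diagonal and even off-diagonal entries, and with $A\equiv I\pmod 4$ if $N$ is even. The Hecke operators of $A$ are all $U_N(g)$ where $g=xI+yA$, $x,y\in\mathbb Z_{N'}$, has determinant $1$ in $\mathbb Z_{N'}$ (and $g\equiv I\pmod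 4$ if $N$ is even). A Hecke eigenfunction is a nonzero $\psi\in L^2(\mathbb Z_N)$ that is an eigenfunction of every Hecke operator; it is normalized if $\|\psi\|_2=1$. **Statement.** Let $N\ge1$, $A$ and $(r_p)_{p\mid N}$ be as above. (1) If $N=ab^2$ with $b$ odd, or $N=2ab^2$ ($a,b$ positive integers), then there is a normalized Hecke eigenfunction $\psi\in L^2(\mathbb Z_N)$ with $\|\psi\|_\infty\ge b^{1/2}$. (2) There is an absolute constant $C>0$ (independent of $N$, $A$ and the $r_p$) such that whenever $N=a^2$ is a perfect square, there is a normalized Hecke eigenfunction $\psi\in L^2(\mathbb Z_N)$ with $\|\psi\|_\infty\ge C\,N^{1/4}$. -/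

import Mathlib

open scoped MatrixGroups

noncomputable section

namespace CatMap

/-- `e(x) = exp(2πix)`. -/
def e (x : ℝ) : ℂ := Complex.exp (2 * Real.pi * Complex.I * x)

/-- The modulus on which `U_N(g)` depends: `N` if `N` is odd and `2N` if `N` is even. -/
def level (N : ℕ) : ℕ := if Even N then 2 * N else N

/-! ### The Weil representation for a prime power `q = p ^ k`

The formulas below are uniform in `q`, with `L = level q`. If `q` is odd, then `L = q` and the phases
are `e(r b x² / q)` and `e(2 r x y / q)` with the unit `r`. If `q = 2 ^ k`, then the phases are
`e(r b x² / (2q))` and `e(r x y / q)` with `r` odd, that is, `r / 2` takes the place of `r`, as is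
needed for the Fourier transform `H` to be invertible.
The phases depend only on the classes of the arguments (`b` is even if `q` is even). -/

section PrimePower

variable (q : ℕ) [NeZero q] (r : ℤ)

/-- The matrix `n_b` with rows `(1, b)` and `(0, 1)`. -/
def upperMat {R : Type*} [CommRing R] (b : R) : SL(2, R) := ⟨!![1, b; 0, 1], by simp⟩

/-- The transpose of `n_c`, with rows `(1, 0)` and `(c, 1)`. -/
def lowerMat {R : Type*} [CommRing R] (c : R) : SL(2, R) := ⟨!![1, 0; c, 1], by simp⟩

/-- The matrix `a_t`, diagonal with entries `t` and `t⁻¹`. -/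
def diagMat {R : Type*} [CommRing R] (t : Rˣ) : SL(2, R) :=
  ⟨!![(t : R), 0; 0, ((t⁻¹ : Rˣ) : R)], by simp⟩

/-- The matrix `ω` with rows `(0, 1)` and `(-1, 0)`. -/
def omegaMat {R : Type*} [CommRing R] : SL(2, R) := ⟨!![0, 1; -1, 0], by simp⟩

/-- The normalized Gauss sum `S_r(a, q) = q^{-1/2} ∑_x e(-r a x² / L)`. -/
def gaussS (a : ℤ) : ℂ :=
  ((Real.sqrt q : ℝ) : ℂ)⁻¹ * ∑ x : ZMod q, e (-(r * a * (x.val : ℝ) ^ 2) / level q)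

/-- The number `Λ(t) = S_r(-t, q) / S_r(-1, q)` of absolute value one. -/
def Lam (t : ZMod (level q)) : ℂ := gaussS q r (-(t.val : ℤ)) / gaussS q r (-1)

/-- `U(n_b) ψ(x) = e(r b x² / L) ψ(x)`. -/
def opUpper (b : ZMod (level q)) : Module.End ℂ (ZMod q → ℂ) where
  toFun ψ x := e (r * (b.val : ℝ) * (x.val : ℝ) ^ 2 / level q) * ψ x
  map_add' ψ φ := by ext x; simp [mul_add]
  map_smul' c ψ := by ext x; simp [mul_left_comm]

/-- `U(a_t) ψ(x) = Λ(t) ψ(t x)`. -/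
def opDiag (t : ZMod (level q)) : Module.End ℂ (ZMod q → ℂ) where
  toFun ψ x := Lam q r t * ψ ((t.val : ZMod q) * x)
  map_add' ψ φ := by ext x; simp [mul_add]
  map_smul' c ψ := by ext x; simp [mul_left_comm]

/-- `U(ω) ψ(x) = S_r(-1, q) q^{-1/2} ∑_y ψ(y) e(2 r x y / L)`; for `q` a power of two this is
the operator `H`. -/
def opFourier : Module.End ℂ (ZMod q → ℂ) where
  toFun ψ x := gaussS q r (-1) / ((Real.sqrt q : ℝ) : ℂ) *
    ∑ y : ZMod q, ψ y * e (2 * r * (x.val : ℝ) * (y.val : ℝ) / level q)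
  map_add' ψ φ := by ext x; simp [add_mul, mul_add, Finset.sum_add_distrib]
  map_smul' c ψ := by
    ext x
    simp only [Pi.smul_apply, smul_eq_mul, RingHom.id_apply, mul_assoc, ← Finset.mul_sum]
    ring

/-- The prescribed values of the representation on generators. For `q` odd these are `n_b`, `a_t`
and `ω`, which generate `SL(2, ℤ/q)`. For `q` a power of two these are the `n_b`, `n_cᵀ` and `a_t`
that are congruent to the identity modulo `4`, which generate the group of all matrices in
`SL(2, ℤ/2q)` that are congruent to the identity modulo `4`. -/
def weilGenerators : Set (SL(2, ZMod (level q)) × Module.End ℂ (ZMod q → ℂ)) :=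
  if Even q then
    {P | (∃ b : ZMod (level q), 4 ∣ b.val ∧ P = (upperMat b, opUpper q r b)) ∨
      (∃ c : ZMod (level q), 4 ∣ c.val ∧
        P = (lowerMat c, Ring.inverse (opFourier q r) * opUpper q r (-c) * opFourier q r)) ∨
      (∃ t : (ZMod (level q))ˣ, (t : ZMod (level q)).val % 4 = 1 ∧
        P = (diagMat t, opDiag q r t))}
  else
    {P | (∃ b : ZMod (level q), P = (upperMat b, opUpper q r b)) ∨
      (∃ t : (ZMod (level q))ˣ, P = (diagMat t, opDiag q r t)) ∨
      P = (omegaMat, opFourier q r)}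

/-- The graph of the representation `g ↦ U_q(g)` that is given on the generators as above: the pair
`(g, V)` belongs to it exactly if `U_q(g) = V`. The set of generators is closed under inversion up
to products, so that the generated submonoid is a group. -/
def weilGraph : Submonoid (SL(2, ZMod (level q)) × Module.End ℂ (ZMod q → ℂ)) :=
  Submonoid.closure (weilGenerators q r)

end PrimePower

/-! ### General `N` -/

/-- The exact power of `p` that divides `N`. -/
def ppart (N p : ℕ) : ℕ := p ^ N.factorization p

instance (N p : ℕ) : NeZero (ppart N p) := ⟨(Nat.ordProj_pos N p).ne'⟩

theorem level_ppart_dvd (N p : ℕ) : level (ppart N p) ∣ level N := by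
  have h : ppart N p ∣ N := Nat.ordProj_dvd N p
  unfold level
  split_ifs with h1 h2 h2
  · exact Nat.mul_dvd_mul_left 2 h
  · exact absurd (even_iff_two_dvd.2 ((even_iff_two_dvd.1 h1).trans h)) h2
  · exact h.mul_left 2
  · exact h

/-- The component at `p` of a matrix. -/
def component {N : ℕ} (g : SL(2, ZMod (level N))) (p : ℕ) : SL(2, ZMod (level (ppart N p))) :=
  Matrix.SpecialLinearGroup.map (ZMod.castHom (level_ppart_dvd N p) _) g

/-- The operator on `L²(ℤ/N)` that corresponds to `⨂_p W_p` under the isomorphism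
`L²(ℤ/N) ≅ ⨂_p L²(ℤ/p^k)` of the Chinese remainder theorem: its matrix is the
product of the matrices of the `W_p`. -/
def tensorOp (N : ℕ) [NeZero N] (W : (p : ℕ) → Module.End ℂ (ZMod (ppart N p) → ℂ)) :
    Module.End ℂ (ZMod N → ℂ) :=
  Matrix.toLin' (Matrix.of fun x y : ZMod N => ∏ p ∈ N.primeFactors,
    LinearMap.toMatrix' (W p) (x.val : ZMod (ppart N p)) (y.val : ZMod (ppart N p)))

/-- `V = U_N(g)`, where `r p` is the unit used in the representation at `p`. If `N` is even, then
`U_N(g)` is defined for `g` congruent to the identity modulo `4`. -/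
def IsPropagator (N : ℕ) [NeZero N] (r : ℕ → ℤ) (g : SL(2, ZMod (level N)))
    (V : Module.End ℂ (ZMod N → ℂ)) : Prop :=
  ∃ W : (p : ℕ) → Module.End ℂ (ZMod (ppart N p) → ℂ),
    (∀ p ∈ N.primeFactors, (component g p, W p) ∈ weilGraph (ppart N p) (r p)) ∧ V = tensorOp N W

/-- The standing assumptions on the matrix `A`. -/
structure IsAdmissible (N : ℕ) (A : SL(2, ℤ)) : Prop where
  hyperbolic : 2 < |A.1.trace|
  odd_diag : ∀ i, Odd (A.1 i i)
  even_offdiag : ∀ i j, i ≠ j → Even (A.1 i j)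
  mod_four : Even N → ∀ i j, A.1 i j ≡ (1 : Matrix (Fin 2) (Fin 2) ℤ) i j [ZMOD 4]

/-- The Hecke operators of `A`: all `U_N(g)` with `g = xI + yA` of determinant one. -/
def IsHeckeOperator (N : ℕ) [NeZero N] (r : ℕ → ℤ) (A : SL(2, ℤ))
    (V : Module.End ℂ (ZMod N → ℂ)) : Prop :=
  ∃ (g : SL(2, ZMod (level N))) (x y : ZMod (level N)),
    g.1 = x • (1 : Matrix (Fin 2) (Fin 2) (ZMod (level N))) + y • A.1.map (fun n : ℤ => (n : ZMod (level N))) ∧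
      IsPropagator N r g V

/-- A Hecke eigenfunction: a joint eigenfunction of all Hecke operators. -/
def IsHeckeEigenfunction (N : ℕ) [NeZero N] (r : ℕ → ℤ) (A : SL(2, ℤ)) (ψ : ZMod N → ℂ) : Prop :=
  ψ ≠ 0 ∧ ∀ V : Module.End ℂ (ZMod N → ℂ), IsHeckeOperator N r A V → ∃ μ : ℂ, V ψ = μ • ψ

/-- The norm of `L²(ℤ/N)`, for the inner product `N⁻¹ ∑ φ(Q) conj(ψ(Q))`. -/
def l2norm {N : ℕ} [NeZero N] (ψ : ZMod N → ℂ) : ℝ :=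
  Real.sqrt ((1 / (N : ℝ)) * ∑ Q : ZMod N, ‖ψ Q‖ ^ 2)

/-- The supremum norm. -/
def supNorm {N : ℕ} [NeZero N] (ψ : ZMod N → ℂ) : ℝ := ⨆ Q : ZMod N, ‖ψ Q‖

end CatMap

end

/-!
Any function `ψ` on `ℤ/N` that lives on the multiples of `b` satisfies `b ‖ψ‖₂² ≤ ‖ψ‖_∞²`, because
only `N / b` of the `N` points contribute to `‖ψ‖₂²` (`sqrt_le_supNorm`). It is therefore enough to
find, for every `b` with `b² ∣ N`, a Hecke eigenfunction that lives on the multiples of `b`; this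
gives the second part with the constant `1`. Such an eigenfunction is a product of local ones
(`isHeckeEigenfunction_tensorFun`).

For `q` a power of two let `b² ∣ q ∣ 2b²`. The indicator function of the multiples of `b` is an
eigenfunction of every generator: the phase `e(r c x² / 2q)` is trivial on its support if `4 ∣ c`, it
is invariant under `x ↦ t x`, and its Fourier transform lives on the multiples of `b` again
(`exists_eigenvalue_indicator_of_even`).

For `q` odd, `U_q(g)` transforms the Heisenberg operators by `V T(w g) = T(w) V` for row vectors `w`
(`implements_of_mem_weilGraph`). Two facts follow. The functions fixed by all `T(w)` with `w`
divisible by `q / b` form an invariant space; it is nonzero, and its elements live on the multiples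
of `b`. And the operators of commuting matrices commute (`Implements.commute`): by Schur's lemma
`V W = c W V` for a scalar `c`, determinants give `c ^ q = 1`, and determinants on the even functions,
a space of dimension `(q + 1) / 2`, give `c ^ (q + 1) = 1`. This replaces the verification that the
generators define a representation. As the matrices `xI + yA` commute, there is a joint eigenvector
in the invariant space (`exists_local_eigenfunction_of_odd`).
-/

noncomputable section

namespace CatMap

/-! ### Heisenberg operators and their intertwiners -/

section Heisenberg

open Matrix

variable {R : Type*} [CommRing R]

/-- The Heisenberg operator `T(u, v) ψ(x) = χ(uv + 2vx) ψ(x + u)` attached to a row vector `(u, v)`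
and an additive character `χ`. -/
def heisenberg (χ : AddChar R ℂ) (w : Fin 2 → R) : Module.End ℂ (R → ℂ) where
  toFun ψ x := χ (w 0 * w 1 + 2 * w 1 * x) * ψ (x + w 0)
  map_add' ψ φ := by ext x; simp [mul_add]
  map_smul' c ψ := by ext x; simp [mul_left_comm]

theorem heisenberg_apply (χ : AddChar R ℂ) (w : Fin 2 → R) (ψ : R → ℂ) (x : R) :
    heisenberg χ w ψ x = χ (w 0 * w 1 + 2 * w 1 * x) * ψ (x + w 0) := rfl

/-- The reflection `ψ(x) ↦ ψ(-x)`. -/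
def reflection (R : Type*) [CommRing R] : Module.End ℂ (R → ℂ) :=
  LinearMap.funLeft ℂ ℂ (fun x : R => -x)

theorem reflection_apply (ψ : R → ℂ) (x : R) : reflection R ψ x = ψ (-x) := rfl

/-- `V` is an injective operator that commutes with the reflection and implements `g` on the
Heisenberg operators: `V T(w g) = T(w) V`. -/
structure Implements (χ : AddChar R ℂ) (g : Matrix (Fin 2) (Fin 2) R) (V : Module.End ℂ (R → ℂ)) : Prop where
  injective : Function.Injective V
  intertwines : ∀ w, V * heisenberg χ (w ᵥ* g) = heisenberg χ w * V
  even : V * reflection R = reflection R * V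

theorem Implements.one (χ : AddChar R ℂ) : Implements χ 1 1 where
  injective := fun _ _ h => h
  intertwines w := by simp
  even := by simp

theorem Implements.mul {χ : AddChar R ℂ} {g h : Matrix (Fin 2) (Fin 2) R}
    {V W : Module.End ℂ (R → ℂ)} (hV : Implements χ g V) (hW : Implements χ h W) : Implements χ (g * h) (V * W) where
  injective := hV.injective.comp hW.injective
  intertwines w := by
    rw [← Matrix.vecMul_vecMul, mul_assoc, hW.intertwines, ← mul_assoc,
      hV.intertwines, mul_assoc]
  even := by rw [mul_assoc, hW.even, ← mul_assoc, hV.even, mul_assoc]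

/-- Schur's lemma for the Heisenberg operators: `δ₀` spans the joint fixed space of the
multiplication operators, and its translates span everything. -/
theorem exists_eq_smul_one_of_commute_heisenberg [Fintype R] [DecidableEq R] {χ : AddChar R ℂ}
    (hχ : χ.IsPrimitive) (h2 : IsUnit (2 : R)) (X : Module.End ℂ (R → ℂ))
    (hX : ∀ w, X * heisenberg χ w = heisenberg χ w * X) : ∃ c : ℂ, X = c • 1 := by
  have hX' : ∀ w ψ, X (heisenberg χ w ψ) = heisenberg χ w (X ψ) := fun w ψ =>
    LinearMap.congr_fun (hX w) ψ
  have hsupp : ∀ x, x ≠ 0 → X (Pi.single 0 1) x = 0 := by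
    intro x hx
    have hne : (2 * x : R) ≠ 0 := by simpa [h2.mul_right_eq_zero] using hx
    obtain ⟨v, hv⟩ : ∃ v, χ ((2 * x) * v) ≠ 1 := by
      have := hχ hne
      rw [AddChar.ne_one_iff] at this
      simpa [AddChar.mulShift_apply] using this
    have hfix : heisenberg χ ![0, v] (Pi.single 0 1) = Pi.single 0 1 := by
      ext y
      by_cases hy : y = 0
      · subst hy; simp [heisenberg_apply]
      · simp [heisenberg_apply, hy]
    have h := congrFun (hX' ![0, v] (Pi.single 0 1)) x
    rw [hfix, heisenberg_apply] at h
    simp only [cons_val_zero, cons_val_one, zero_mul, zero_add, add_zero] at h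
    rw [show 2 * v * x = 2 * x * v by ring] at h
    have h' : (χ (2 * x * v) - 1) * X (Pi.single 0 1) x = 0 := by linear_combination -h
    exact (mul_eq_zero.1 h').resolve_left (sub_ne_zero.2 hv)
  refine ⟨X (Pi.single 0 1) 0, LinearMap.pi_ext' fun y => LinearMap.ext_ring ?_⟩
  have htr : heisenberg χ ![-y, 0] (Pi.single 0 1) = Pi.single y 1 := by
    ext z
    simp [heisenberg_apply, Pi.single_apply, ← sub_eq_add_neg, sub_eq_zero]
  ext z
  have h := congrFun (hX' ![-y, 0] (Pi.single 0 1)) z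
  rw [htr, heisenberg_apply] at h
  simp only [LinearMap.comp_apply, LinearMap.single_apply, LinearMap.smul_apply,
    Module.End.one_apply, Pi.smul_apply, smul_eq_mul]
  rw [h]
  by_cases hz : z = y
  · subst hz; simp
  · have : z + -y ≠ 0 := by rwa [← sub_eq_add_neg, sub_ne_zero]
    simp [hsupp _ this, hz]

/-- Compare the determinants of both sides. -/
theorem pow_finrank_eq_one_of_mul_eq_smul_mul {M : Type*} [AddCommGroup M] [Module ℂ M]
    [FiniteDimensional ℂ M] {f g : Module.End ℂ M} (hf : Function.Injective f)
    (hg : Function.Injective g) {c : ℂ} (h : f * g = c • (g * f)) :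
    c ^ Module.finrank ℂ M = 1 := by
  have hdet : ∀ k : Module.End ℂ M, Function.Injective k → LinearMap.det k ≠ 0 := fun k hk =>
    (LinearMap.isUnit_det k
      ((LinearMap.isUnit_iff_ker_eq_bot k).2 (LinearMap.ker_eq_bot.2 hk))).ne_zero
  have := congrArg LinearMap.det h
  rw [LinearMap.det_smul, map_mul, map_mul, mul_comm (LinearMap.det g)] at this
  exact (mul_eq_right₀ (mul_ne_zero (hdet f hf) (hdet g hg))).1 this.symm

/-- If `2` is invertible, then `0` is the only fixed point of `x ↦ -x`, so that the reflection has
trace `1` and the space of even functions has dimension `(|R| + 1) / 2`. -/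
theorem two_mul_finrank_ker_reflection_sub_one [Fintype R] [DecidableEq R]
    (h2 : IsUnit (2 : R)) :
    2 * Module.finrank ℂ (LinearMap.ker (reflection R - 1)) = Fintype.card R + 1 := by
  have hproj : LinearMap.IsProj (LinearMap.ker (reflection R - 1))
      ((1 / 2 : ℂ) • (1 + reflection R)) := by
    constructor
    · intro ψ
      rw [LinearMap.mem_ker]
      ext x
      simp [reflection_apply, add_comm]
    · intro ψ hψ
      rw [LinearMap.mem_ker, LinearMap.sub_apply, sub_eq_zero] at hψ
      simp only [LinearMap.smul_apply, LinearMap.add_apply, hψ, Module.End.one_apply]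
      ext x
      simp only [Pi.smul_apply, Pi.add_apply, smul_eq_mul]
      ring
  have htr : LinearMap.trace ℂ (R → ℂ) (reflection R) = 1 := by
    rw [LinearMap.trace_eq_matrix_trace ℂ (Pi.basisFun ℂ R)]
    simp only [Matrix.trace, Matrix.diag, LinearMap.toMatrix_apply, Pi.basisFun_apply,
      Pi.basisFun_repr, reflection_apply]
    rw [Finset.sum_eq_single 0]
    · simp
    · intro x _ hx
      refine Pi.single_eq_of_ne (fun h => hx ?_) _
      have : 2 * x = 0 := by linear_combination -h
      simpa [h2.mul_right_eq_zero] using this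
    · simp
  have h := hproj.trace
  rw [map_smul, map_add, htr, LinearMap.trace_one, Module.finrank_fintype_fun_eq_card] at h
  have h' : (2 * (Module.finrank ℂ (LinearMap.ker (reflection R - 1)) : ℂ)) =
      Fintype.card R + 1 := by
    rw [← h, smul_eq_mul]; ring
  exact_mod_cast h'

/-- Implementers of commuting matrices commute. By Schur's lemma they commute up to a scalar `c`.
Taking determinants on all functions and on the even functions gives `c ^ |R| = 1` and
`c ^ (|R| + 1) = 1`. -/
theorem Implements.commute [Fintype R] {χ : AddChar R ℂ} (hχ : χ.IsPrimitive)
    (h2 : IsUnit (2 : R)) {g h : Matrix (Fin 2) (Fin 2) R} (hgh : g * h = h * g)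
    (hunit : IsUnit (g * h)) {V W : Module.End ℂ (R → ℂ)}
    (hV : Implements χ g V) (hW : Implements χ h W) : V * W = W * V := by
  classical
  have hVW := hV.mul hW
  have hWV := hW.mul hV
  obtain ⟨c, hc⟩ : ∃ c : ℂ, V * W = c • (W * V) := by
    -- `(W V)⁻¹ V W` commutes with every `T(w g h)`, hence with all Heisenberg operators.
    obtain ⟨U, hU⟩ := (LinearMap.isUnit_iff_ker_eq_bot _).2 (LinearMap.ker_eq_bot.2 hWV.injective)
    obtain ⟨c, hc⟩ := exists_eq_smul_one_of_commute_heisenberg hχ h2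
      ((U⁻¹ : (Module.End ℂ (R → ℂ))ˣ) * (V * W)) (fun w => by
        obtain ⟨w', rfl⟩ : ∃ w', w = w' ᵥ* (g * h) := by
          obtain ⟨k, hk⟩ := hunit
          refine ⟨w ᵥ* (k⁻¹ : (Matrix (Fin 2) (Fin 2) R)ˣ).1, ?_⟩
          rw [Matrix.vecMul_vecMul, ← hk, Units.inv_mul, Matrix.vecMul_one]
        have h1 := hWV.intertwines w'
        rw [← hgh, ← hU] at h1
        rw [mul_assoc, hVW.intertwines, ← mul_assoc, ← mul_assoc (heisenberg _ _)]
        congr 1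
        rw [Units.inv_mul_eq_iff_eq_mul, ← mul_assoc, h1, mul_assoc, Units.mul_inv, mul_one])
    refine ⟨c, ?_⟩
    rw [Units.inv_mul_eq_iff_eq_mul, hU] at hc
    rw [hc, mul_smul_comm, mul_one]
  have h1 := pow_finrank_eq_one_of_mul_eq_smul_mul hV.injective hW.injective hc
  rw [Module.finrank_fintype_fun_eq_card] at h1
  have hmaps : ∀ {Z : Module.End ℂ (R → ℂ)}, Z * reflection R = reflection R * Z →
      ∀ ψ ∈ LinearMap.ker (reflection R - 1), Z ψ ∈ LinearMap.ker (reflection R - 1) := by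
    intro Z hZ ψ hψ
    rw [LinearMap.mem_ker, LinearMap.sub_apply, sub_eq_zero] at hψ ⊢
    rw [← Module.End.mul_apply, ← hZ, Module.End.mul_apply, hψ]
    rfl
  have h3 : c ^ Module.finrank ℂ (LinearMap.ker (reflection R - 1)) = 1 := by
    refine pow_finrank_eq_one_of_mul_eq_smul_mul (f := V.restrict (hmaps hV.even))
      (g := W.restrict (hmaps hW.even)) ?_ ?_ ?_
    · exact fun x y hxy => Subtype.ext (hV.injective (congrArg Subtype.val hxy))
    · exact fun x y hxy => Subtype.ext (hW.injective (congrArg Subtype.val hxy))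
    · exact LinearMap.ext fun x => Subtype.ext (LinearMap.congr_fun hc x.1)
  have h4 : c ^ (Fintype.card R + 1) = 1 := by
    rw [← two_mul_finrank_ker_reflection_sub_one h2, mul_comm, pow_mul, h3, one_pow]
  rw [pow_succ, h1, one_mul] at h4
  rw [hc, h4, one_smul]

end Heisenberg

/-! ### Joint eigenvectors -/

/-- Pairwise commuting operators that preserve a nonzero finite-dimensional subspace have a joint
eigenvector in it. -/
theorem exists_joint_eigenvector {M : Type*} [AddCommGroup M] [Module ℂ M] [FiniteDimensional ℂ M]
    (𝒯 : Set (Module.End ℂ M)) (hcomm : ∀ f ∈ 𝒯, ∀ g ∈ 𝒯, f * g = g * f) (S : Submodule ℂ M)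
    (hS : S ≠ ⊥) (hinv : ∀ f ∈ 𝒯, ∀ v ∈ S, f v ∈ S) :
    ∃ v ∈ S, v ≠ 0 ∧ ∀ f ∈ 𝒯, ∃ μ : ℂ, f v = μ • v := by
  induction S using WellFoundedLT.induction with
  | ind S ih =>
    by_cases hscal : ∀ f ∈ 𝒯, ∃ μ : ℂ, ∀ v ∈ S, f v = μ • v
    · obtain ⟨v, hv, hv0⟩ := S.ne_bot_iff.1 hS
      exact ⟨v, hv, hv0, fun f hf => (hscal f hf).imp fun μ h => h v hv⟩
    · push Not at hscal
      obtain ⟨f, hf, hns⟩ := hscal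
      have : Nontrivial S := Submodule.nontrivial_iff_ne_bot.2 hS
      obtain ⟨μ, hμ⟩ := Module.End.exists_eigenvalue (f.restrict (hinv f hf))
      obtain ⟨v, hv⟩ := hμ.exists_hasEigenvector
      -- `f` is not scalar on `S`, so its eigenspace in `S` is smaller than `S`.
      obtain ⟨w, hw, hwne⟩ := hns μ
      have hfv : f v = μ • (v : M) := congrArg Subtype.val hv.apply_eq_smul
      obtain ⟨u, hu, hu0, hev⟩ := ih (S ⊓ Module.End.eigenspace f μ)
        (lt_of_le_of_ne inf_le_left fun h => hwne
          (Module.End.mem_eigenspace_iff.1 ((h.symm ▸ hw : w ∈ S ⊓ _).2)))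
        (Submodule.ne_bot_iff _ |>.2 ⟨v, ⟨v.2, Module.End.mem_eigenspace_iff.2 hfv⟩,
          fun h => hv.2 (Subtype.ext h)⟩)
        (fun g hg x hx => ⟨hinv g hg x hx.1, Module.End.mem_eigenspace_iff.2 <| by
          rw [← Module.End.mul_apply, hcomm f hf g hg, Module.End.mul_apply,
            Module.End.mem_eigenspace_iff.1 hx.2, map_smul]⟩)
      exact ⟨u, hu.1, hu0, hev⟩

/-! ### Operators that implement the generators -/

section Generators

open Matrix

variable {R : Type*} [CommRing R] {χ : AddChar R ℂ} {V : Module.End ℂ (R → ℂ)}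

theorem implements_upper {b : R} (hV : ∀ ψ x, V ψ x = χ (b * x ^ 2) * ψ x) :
    Implements χ !![1, b; 0, 1] V where
  injective ψ φ h := by
    ext x
    have := congrFun h x
    rw [hV, hV] at this
    exact mul_left_cancel₀ (χ.val_isUnit _).ne_zero this
  intertwines w := by
    refine LinearMap.ext fun ψ => funext fun x => ?_
    simp only [Module.End.mul_apply, hV, heisenberg_apply, vecMul, dotProduct, Fin.sum_univ_two,
      of_apply, cons_val', cons_val_zero, cons_val_one, cons_val_fin_one, mul_one, mul_zero,
      add_zero, ← mul_assoc, ← AddChar.map_add_eq_mul]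
    congr 2
    ring
  even := by
    refine LinearMap.ext fun ψ => funext fun x => ?_
    simp only [Module.End.mul_apply, hV, reflection_apply, neg_sq]

theorem implements_diag {k : ℂ} (hk : k ≠ 0) {t s : R} (hts : t * s = 1)
    (hV : ∀ ψ x, V ψ x = k * ψ (t * x)) : Implements χ !![t, 0; 0, s] V where
  injective ψ φ h := by
    ext x
    have := congrFun h (s * x)
    rw [hV, hV, ← mul_assoc, hts, one_mul] at this
    exact mul_left_cancel₀ hk this
  intertwines w := by
    refine LinearMap.ext fun ψ => funext fun x => ?_
    simp only [Module.End.mul_apply, hV, heisenberg_apply, vecMul, dotProduct, Fin.sum_univ_two,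
      of_apply, cons_val', cons_val_zero, cons_val_one, cons_val_fin_one, mul_zero, add_zero,
      zero_add]
    have hexp : w 0 * t * (w 1 * s) + 2 * (w 1 * s) * (t * x) = w 0 * w 1 + 2 * w 1 * x := by
      linear_combination (w 0 * w 1 + 2 * w 1 * x) * hts
    rw [hexp, mul_left_comm, show t * x + w 0 * t = t * (x + w 0) by ring]
  even := by
    refine LinearMap.ext fun ψ => funext fun x => ?_
    simp only [Module.End.mul_apply, hV, reflection_apply, mul_neg]

/-- The square of a Fourier transform is a nonzero multiple of the reflection. -/
theorem injective_of_fourier [Fintype R] (hχ : χ.IsPrimitive) {k : ℂ} (hk : k ≠ 0)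
    (hV : ∀ ψ x, V ψ x = k * ∑ y, ψ y * χ (x * y)) : Function.Injective V := by
  classical
  have hsq : ∀ ψ x, V (V ψ) x = k ^ 2 * Fintype.card R * ψ (-x) := by
    intro ψ x
    calc V (V ψ) x = k ^ 2 * ∑ y, ∑ z, ψ z * χ (y * (z + x)) := by
          rw [hV, pow_two, mul_assoc k k]
          congr 1
          rw [Finset.mul_sum]
          refine Finset.sum_congr rfl fun y _ => ?_
          rw [hV, mul_assoc, Finset.sum_mul]
          congr 1
          refine Finset.sum_congr rfl fun z _ => ?_
          rw [mul_assoc, ← AddChar.map_add_eq_mul]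
          congr 2
          ring
      _ = _ := by
          rw [Finset.sum_comm]
          simp_rw [← Finset.mul_sum, AddChar.sum_mulShift _ hχ, add_eq_zero_iff_eq_neg]
          simp
          ring
  intro ψ φ h
  ext x
  have h' : V (V ψ) (-x) = V (V φ) (-x) := by rw [h]
  rw [hsq, hsq, neg_neg] at h'
  exact mul_left_cancel₀ (mul_ne_zero (pow_ne_zero 2 hk)
    (Nat.cast_ne_zero.2 Fintype.card_ne_zero)) h'

theorem isPrimitive_mulShift (hχ : χ.IsPrimitive) {c : R} (hc : IsUnit c) :
    (χ.mulShift c).IsPrimitive := by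
  intro a ha
  rw [AddChar.mulShift_mulShift]
  exact hχ (by simpa [hc.mul_right_eq_zero] using ha)

theorem implements_fourier [Fintype R] (hχ : χ.IsPrimitive) (h2 : IsUnit (2 : R)) {k : ℂ}
    (hk : k ≠ 0) (hV : ∀ ψ x, V ψ x = k * ∑ y, ψ y * χ (2 * x * y)) :
    Implements χ !![0, 1; -1, 0] V where
  injective := by
    refine injective_of_fourier (isPrimitive_mulShift hχ h2) hk fun ψ x => ?_
    simp only [hV, AddChar.mulShift_apply, mul_assoc]
  intertwines w := by
    refine LinearMap.ext fun ψ => funext fun x => ?_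
    simp only [Module.End.mul_apply, hV, heisenberg_apply, vecMul, dotProduct, Fin.sum_univ_two,
      of_apply, cons_val', cons_val_zero, cons_val_one, cons_val_fin_one, mul_zero, add_zero,
      zero_add, mul_one, mul_neg]
    rw [mul_left_comm, Finset.mul_sum _ _ (χ _)]
    congr 1
    refine Fintype.sum_equiv (Equiv.addRight (-w 1)) _ _ fun y => ?_
    rw [Equiv.coe_addRight, mul_left_comm (χ _) (ψ _), ← AddChar.map_add_eq_mul,
      mul_comm (χ _) (ψ _), mul_assoc, ← AddChar.map_add_eq_mul]
    congr 2
    ring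
  even := by
    refine LinearMap.ext fun ψ => funext fun x => ?_
    simp only [Module.End.mul_apply, hV, reflection_apply]
    congr 1
    refine Fintype.sum_equiv (Equiv.neg R) _ _ fun y => ?_
    simp

/-- The Gauss sum of a character of second degree `f` that is associated with a primitive additive
character does not vanish: its product with the sum of `f⁻¹` is the cardinality of the ring. -/
theorem sum_ne_zero_of_second_degree [Fintype R] (hχ : χ.IsPrimitive) {f : R → ℂ} (hf0 : f 0 = 1)
    (hf : ∀ u x, f (u + x) = f u * f x * χ (x * u)) : ∑ x, f x ≠ 0 := by
  classical
  have hne : ∀ x, f x ≠ 0 := fun x hx => by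
    have := hf (-x) x
    rw [neg_add_cancel, hf0, hx, mul_zero, zero_mul] at this
    exact one_ne_zero this
  have h : (∑ x, f x) * ∑ x, (f x)⁻¹ = Fintype.card R := by
    calc (∑ x, f x) * ∑ x, (f x)⁻¹ = ∑ x, ∑ u, f (u + x) * (f x)⁻¹ := by
          rw [Finset.mul_sum]
          refine Finset.sum_congr rfl fun x _ => ?_
          rw [Finset.sum_mul]
          exact (Fintype.sum_equiv (Equiv.addRight x) _ _ fun u => rfl).symm
      _ = ∑ u, f u * ∑ x, χ (x * u) := by
          rw [Finset.sum_comm]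
          refine Finset.sum_congr rfl fun u _ => ?_
          rw [Finset.mul_sum]
          refine Finset.sum_congr rfl fun x _ => ?_
          rw [hf]
          field_simp [hne x]
      _ = Fintype.card R := by
          simp_rw [AddChar.sum_mulShift _ hχ]
          simp [hf0]
  intro h0
  rw [h0, zero_mul] at h
  exact Nat.cast_ne_zero.2 Fintype.card_ne_zero h.symm

/-- The functions fixed by the Heisenberg operators of all vectors divisible by `d`. -/
def fixedSpace (χ : AddChar R ℂ) (d : R) : Submodule ℂ (R → ℂ) :=
  ⨅ w : Fin 2 → R, LinearMap.ker (heisenberg χ (d • w) - 1)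

theorem mem_fixedSpace {d : R} {ψ : R → ℂ} :
    ψ ∈ fixedSpace χ d ↔ ∀ w, heisenberg χ (d • w) ψ = ψ := by
  simp [fixedSpace, Submodule.mem_iInf, sub_eq_zero]

/-- `T(dw) V = V T(d(wg))`, and `d(wg)` is again divisible by `d`. -/
theorem Implements.map_mem_fixedSpace {g : Matrix (Fin 2) (Fin 2) R} (h : Implements χ g V) {d : R}
    {ψ : R → ℂ} (hψ : ψ ∈ fixedSpace χ d) : V ψ ∈ fixedSpace χ d := by
  rw [mem_fixedSpace] at hψ ⊢
  intro w
  rw [← Module.End.mul_apply, ← h.intertwines, Module.End.mul_apply, smul_vecMul, hψ]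

end Generators

/-! ### Eigenfunctions for odd prime powers -/

theorem e_intCast_div (n : ℕ) [NeZero n] (m : ℤ) :
    e ((m : ℝ) / n) = ZMod.stdAddChar (m : ZMod n) := by
  rw [ZMod.stdAddChar_coe, e]
  push_cast
  congr 1
  ring

theorem dvd_level (q : ℕ) : q ∣ level q := by
  unfold level
  split_ifs
  exacts [dvd_mul_left q 2, dvd_rfl]

theorem level_of_odd {q : ℕ} (hq : Odd q) : level q = q := if_neg (Nat.not_even_iff_odd.2 hq)

/-- The additive character `z ↦ e(r z / q)` of `ℤ/q`. -/
def weilChar (q : ℕ) [NeZero q] (r : ℤ) : AddChar (ZMod q) ℂ :=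
  ZMod.stdAddChar.mulShift (r : ZMod q)

theorem isUnit_two_of_odd {q : ℕ} (hq : Odd q) : IsUnit (2 : ZMod q) := by
  have := (ZMod.isUnit_iff_coprime 2 q).2 (Nat.coprime_two_left.2 hq)
  exact_mod_cast this

section Odd

variable {q : ℕ} [NeZero q] {r : ℤ}

theorem weilChar_intCast (m : ℤ) : weilChar q r (m : ZMod q) = e ((r * m : ℝ) / q) := by
  rw [weilChar, AddChar.mulShift_apply, ← Int.cast_mul, ← e_intCast_div]
  push_cast
  rfl

theorem isUnit_intCast_of_isCoprime (hr : IsCoprime r q) : IsUnit (r : ZMod q) := by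
  obtain ⟨u, v, huv⟩ := hr
  refine IsUnit.of_mul_eq_one (u : ZMod q) ?_
  have := congrArg (Int.cast : ℤ → ZMod q) huv
  push_cast at this
  rw [ZMod.natCast_self, mul_zero, add_zero] at this
  rwa [mul_comm]

theorem weilChar_isPrimitive (hr : IsCoprime r q) : (weilChar q r).IsPrimitive :=
  isPrimitive_mulShift (ZMod.isPrimitive_stdAddChar q) (isUnit_intCast_of_isCoprime hr)

theorem opUpper_apply_of_odd (hq : Odd q) (b : ZMod (level q)) (ψ : ZMod q → ℂ) (x : ZMod q) :
    opUpper q r b ψ x =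
      weilChar q r (ZMod.castHom (dvd_level q) (ZMod q) b * x ^ 2) * ψ x := by
  have : (ZMod.castHom (dvd_level q) (ZMod q) b * x ^ 2) = ((b.val * x.val ^ 2 : ℤ) : ZMod q) := by
    have : NeZero (level q) := ⟨by rw [level_of_odd hq]; exact NeZero.ne q⟩
    push_cast
    rw [ZMod.natCast_val b, ZMod.natCast_zmod_val, ZMod.castHom_apply]
  rw [this, weilChar_intCast]
  simp only [opUpper, LinearMap.coe_mk, AddHom.coe_mk, level_of_odd hq]
  push_cast
  ring_nf

theorem gaussS_ne_zero_of_odd (hq : Odd q) (hr : IsCoprime r q) {a : ℤ}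
    (ha : IsUnit (a : ZMod q)) : gaussS q r a ≠ 0 := by
  have h : ∀ x : ZMod q, e (-(r * a * (x.val : ℝ) ^ 2) / level q) =
      weilChar q r (-(a : ZMod q) * x ^ 2) := by
    intro x
    have : (-(a : ZMod q) * x ^ 2) = ((-a * x.val ^ 2 : ℤ) : ZMod q) := by
      push_cast
      rw [ZMod.natCast_zmod_val]
    rw [this, weilChar_intCast, level_of_odd hq]
    push_cast
    ring_nf
  unfold gaussS
  simp_rw [h]
  refine mul_ne_zero (by simp [NeZero.ne q]) (sum_ne_zero_of_second_degree
    (isPrimitive_mulShift (weilChar_isPrimitive hr) ((isUnit_two_of_odd hq).mul ha.neg))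
    (by simp) fun u x => ?_)
  rw [AddChar.mulShift_apply, ← AddChar.map_add_eq_mul, ← AddChar.map_add_eq_mul]
  congr 1
  ring

theorem opFourier_apply_of_odd (hq : Odd q) (ψ : ZMod q → ℂ) (x : ZMod q) :
    opFourier q r ψ x = gaussS q r (-1) / ((Real.sqrt q : ℝ) : ℂ) *
      ∑ y, ψ y * weilChar q r (2 * x * y) := by
  simp only [opFourier, LinearMap.coe_mk, AddHom.coe_mk]
  congr 1
  refine Finset.sum_congr rfl fun y _ => ?_
  have : 2 * x * y = ((2 * x.val * y.val : ℤ) : ZMod q) := by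
    push_cast
    rw [ZMod.natCast_zmod_val, ZMod.natCast_zmod_val]
  rw [this, weilChar_intCast, level_of_odd hq]
  push_cast
  ring_nf

/-- For odd `q` the operator `U_q(g)` implements the reduction of `g` modulo `q` on the Heisenberg
operators. -/
theorem implements_of_mem_weilGraph (hq : Odd q) (hr : IsCoprime r q)
    {P : SL(2, ZMod (level q)) × Module.End ℂ (ZMod q → ℂ)} (hP : P ∈ weilGraph q r) :
    Implements (weilChar q r) (P.1.1.map (ZMod.castHom (dvd_level q) (ZMod q))) P.2 := by
  have : NeZero (level q) := ⟨by rw [level_of_odd hq]; exact NeZero.ne q⟩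
  induction hP using Submonoid.closure_induction with
  | mem P hP =>
    rw [weilGenerators, if_neg (Nat.not_even_iff_odd.2 hq)] at hP
    rcases hP with ⟨b, rfl⟩ | ⟨t, rfl⟩ | rfl
    · convert implements_upper (opUpper_apply_of_odd hq b) using 1
      ext i j; fin_cases i <;> fin_cases j <;> simp [-ZMod.castHom_apply, upperMat]
    · have hval : ((t : ZMod (level q)).val : ZMod q) =
          ZMod.castHom (dvd_level q) (ZMod q) (t : ZMod (level q)) := by
        rw [ZMod.natCast_val, ZMod.castHom_apply]
      have hunit : IsUnit (((t : ZMod (level q)).val : ℤ) : ZMod q) := by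
        rw [Int.cast_natCast, hval]
        exact t.isUnit.map _
      convert implements_diag (χ := weilChar q r) (V := opDiag q r t) (k := Lam q r t)
        (t := ZMod.castHom (dvd_level q) (ZMod q) (t : ZMod (level q)))
        (s := ZMod.castHom (dvd_level q) (ZMod q) ((t⁻¹ : (ZMod (level q))ˣ) : ZMod (level q)))
        ?_ ?_ ?_ using 1
      · ext i j; fin_cases i <;> fin_cases j <;> simp [-ZMod.castHom_apply, diagMat]
      · refine div_ne_zero (gaussS_ne_zero_of_odd hq hr ?_) (gaussS_ne_zero_of_odd hq hr ?_)
        · rw [Int.cast_neg]; exact hunit.neg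
        · simp
      · rw [← map_mul, Units.mul_inv, map_one]
      · intro ψ x
        rw [← hval]; rfl
    · convert implements_fourier (weilChar_isPrimitive hr) (isUnit_two_of_odd hq) ?_
        (opFourier_apply_of_odd (r := r) hq) using 1
      · ext i j; fin_cases i <;> fin_cases j <;> simp [-ZMod.castHom_apply, omegaMat]
      · exact div_ne_zero (gaussS_ne_zero_of_odd hq hr (by simp)) (by simp [NeZero.ne q])
  | one =>
    convert Implements.one (weilChar q r) using 1
    · ext i j; fin_cases i <;> fin_cases j <;> simp [-ZMod.castHom_apply]
    · rfl
  | mul P Q _ _ hP hQ =>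
    convert hP.mul hQ using 1
    · rw [← Matrix.map_mul]; rfl
    · rfl

/-- The Hecke eigenfunctions for odd `q`: the functions fixed by the Heisenberg operators of all
vectors divisible by `q / b` live on the multiples of `b`, they form a nonzero space because the
indicator function of the multiples of `b` is one of them, and the commuting Hecke operators
preserve this space. -/
theorem exists_local_eigenfunction_of_odd (hq : Odd q) (hr : IsCoprime r q) {b : ℕ}
    (hb : b ^ 2 ∣ q) (A : Matrix (Fin 2) (Fin 2) (ZMod (level q))) :
    ∃ ψ : ZMod q → ℂ, ψ ≠ 0 ∧ (∀ x, ψ x ≠ 0 → b ∣ x.val) ∧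
      ∀ g V, (g, V) ∈ weilGraph q r → (∃ x y : ZMod (level q), g.1 = x • 1 + y • A) →
        ∃ μ : ℂ, V ψ = μ • ψ := by
  obtain ⟨a, ha⟩ := hb
  have hχ := weilChar_isPrimitive hr
  have h2 := isUnit_two_of_odd hq
  set d : ZMod q := ((b * a : ℕ) : ZMod q) with hd
  have hbd : (b : ZMod q) * d = 0 := by
    rw [hd, ← Nat.cast_mul, ← mul_assoc, ← pow_two, ← ha, ZMod.natCast_self]
  obtain ⟨ψ, hψS, hψ0, hψ⟩ := exists_joint_eigenvector
    {V | ∃ g, (g, V) ∈ weilGraph q r ∧ ∃ x y : ZMod (level q), g.1 = x • 1 + y • A}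
    (by
      rintro V ⟨g, hV, x, y, hg⟩ W ⟨h, hW, z, t, hh⟩
      have hgh : g.1 * h.1 = h.1 * g.1 := by
        rw [hg, hh]
        simp only [add_mul, mul_add, smul_mul_smul_comm, one_mul, mul_one, mul_comm]
        abel
      have hu : IsUnit (g.1 * h.1) := by
        rw [Matrix.isUnit_iff_isUnit_det, Matrix.det_mul, g.2, h.2, one_mul]
        exact isUnit_one
      refine (implements_of_mem_weilGraph hq hr hV).commute hχ h2 ?_ ?_
        (implements_of_mem_weilGraph hq hr hW)
      · rw [← Matrix.map_mul, hgh, Matrix.map_mul]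
      · rw [← Matrix.map_mul]
        exact hu.map (ZMod.castHom (dvd_level q) (ZMod q)).mapMatrix)
    (fixedSpace (weilChar q r) d)
    (by
      classical
      refine (Submodule.ne_bot_iff _).2
        ⟨fun x => if (b : ZMod q) ∣ x then 1 else 0, mem_fixedSpace.2 fun w => ?_, fun h => ?_⟩
      · have hbd' : (b : ZMod q) ∣ d := by rw [hd, Nat.cast_mul]; exact dvd_mul_right _ _
        ext x
        rw [heisenberg_apply]
        simp only [Pi.smul_apply, smul_eq_mul]
        simp only [dvd_add_left (hbd'.mul_right (w 0))]
        split_ifs with hx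
        · obtain ⟨y, rfl⟩ := hx
          obtain ⟨k, hk⟩ := hbd'
          have : d * w 0 * (d * w 1) + 2 * (d * w 1) * (b * y) = 0 := by
            linear_combination (2 * w 1 * y + w 0 * w 1 * k) * hbd + w 0 * w 1 * d * hk
          rw [this, AddChar.map_zero_eq_one, one_mul]
        · rw [mul_zero]
      · simpa using congrFun h 0)
    (by
      rintro V ⟨g, hV, -⟩ ψ hψ
      exact (implements_of_mem_weilGraph hq hr hV).map_mem_fixedSpace hψ)
  refine ⟨ψ, hψ0, fun x hx => ?_, fun g V hV hg => hψ V ⟨g, hV, hg⟩⟩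
  -- `T(0, dv)` multiplies by `χ(2dvx)`, which for `ψ x ≠ 0` has to be `1` for all `v`.
  have hdx : d * x = 0 := by
    by_contra hne
    have hne' : 2 * (d * x) ≠ 0 := by simpa [h2.mul_right_eq_zero] using hne
    obtain ⟨v, hv⟩ : ∃ v, weilChar q r (2 * (d * x) * v) ≠ 1 := by
      have := hχ hne'
      rw [AddChar.ne_one_iff] at this
      simpa [AddChar.mulShift_apply] using this
    have h := congrFun (mem_fixedSpace.1 hψS ![0, v]) x
    rw [heisenberg_apply] at h
    simp only [Pi.smul_apply, smul_eq_mul, Matrix.cons_val_zero, Matrix.cons_val_one, mul_zero,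
      zero_mul, zero_add, add_zero] at h
    rw [show 2 * (d * v) * x = 2 * (d * x) * v by ring] at h
    exact hv ((mul_eq_right₀ hx).1 h)
  rw [hd, ← ZMod.natCast_zmod_val x, ← Nat.cast_mul, ZMod.natCast_eq_zero_iff] at hdx
  obtain ⟨k, hk⟩ := hdx
  have hab : 0 < b * a := Nat.pos_of_ne_zero fun h => NeZero.ne q (by
    rw [ha, pow_two, mul_assoc, h, mul_zero])
  refine ⟨k, Nat.eq_of_mul_eq_mul_left hab (hk.trans ?_)⟩
  rw [ha]
  ring

end Odd

/-! ### Eigenfunctions for powers of two -/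

theorem natCast_dvd_iff {q : ℕ} [NeZero q] {b : ℕ} (hb : b ∣ q) (x : ZMod q) :
    (b : ZMod q) ∣ x ↔ b ∣ x.val := by
  constructor
  · rintro ⟨y, rfl⟩
    rw [ZMod.val_mul, Nat.dvd_mod_iff hb, ZMod.val_natCast]
    exact ((Nat.dvd_mod_iff hb).2 dvd_rfl).mul_right _
  · rintro ⟨k, hk⟩
    exact ⟨k, by rw [← ZMod.natCast_zmod_val x, hk, Nat.cast_mul]⟩

theorem e_intCast (m : ℤ) : e m = 1 := by
  rw [e, ← Complex.exp_int_mul_two_pi_mul_I m]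
  push_cast
  congr 1
  ring

theorem e_add (x y : ℝ) : e (x + y) = e x * e y := by
  rw [e, e, e, ← Complex.exp_add]
  push_cast
  congr 1
  ring

theorem level_of_even {q : ℕ} (hq : Even q) : level q = 2 * q := if_pos hq

section Even

variable {q : ℕ} [NeZero q] {r : ℤ}

theorem opFourier_apply_of_even (hq : Even q) (ψ : ZMod q → ℂ) (x : ZMod q) :
    opFourier q r ψ x = gaussS q r (-1) / ((Real.sqrt q : ℝ) : ℂ) *
      ∑ y, ψ y * weilChar q r (x * y) := by
  simp only [opFourier, LinearMap.coe_mk, AddHom.coe_mk]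
  congr 1
  refine Finset.sum_congr rfl fun y _ => ?_
  have : x * y = ((x.val * y.val : ℤ) : ZMod q) := by
    push_cast
    rw [ZMod.natCast_zmod_val, ZMod.natCast_zmod_val]
  rw [this, weilChar_intCast, level_of_even hq]
  push_cast
  congr 2
  rw [mul_assoc, mul_assoc, mul_div_mul_left _ _ two_ne_zero]

/-- For even `q` the phase `e(r m² / 2q)` depends only on `m` modulo `q`. -/
theorem e_sq_div_congr (hq : Even q) {m n : ℤ} (h : (m : ZMod q) = n) :
    e (r * (m : ℝ) ^ 2 / (2 * q)) = e (r * (n : ℝ) ^ 2 / (2 * q)) := by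
  obtain ⟨k, hk⟩ := (ZMod.intCast_eq_intCast_iff_dvd_sub n m q).1 h.symm
  obtain ⟨s, hs⟩ := even_iff_two_dvd.1 hq
  have hq0 : (q : ℝ) ≠ 0 := Nat.cast_ne_zero.2 (NeZero.ne q)
  have hm : (m : ℝ) = n + q * k := by
    exact_mod_cast sub_eq_iff_eq_add'.1 hk
  have hs' : (q : ℝ) = 2 * s := by exact_mod_cast hs
  have : (r * (m : ℝ) ^ 2 / (2 * q)) =
      r * (n : ℝ) ^ 2 / (2 * q) + ((r * (n * k + s * k ^ 2) : ℤ) : ℝ) := by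
    rw [hm]
    field_simp
    push_cast
    linear_combination (r * q * k ^ 2 : ℝ) * hs'
  rw [this, e_add, e_intCast, mul_one]

theorem gaussS_neg_one_ne_zero_of_even (hq : Even q) (hr : IsCoprime r q) :
    gaussS q r (-1) ≠ 0 := by
  have h : ∀ x : ZMod q, e (-(r * (-1 : ℤ) * (x.val : ℝ) ^ 2) / level q) =
      e (r * ((x.val : ℤ) : ℝ) ^ 2 / (2 * q)) := by
    intro x
    rw [level_of_even hq]
    push_cast
    ring_nf
  unfold gaussS
  simp_rw [h]
  refine mul_ne_zero (by simp [NeZero.ne q]) (sum_ne_zero_of_second_degree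
    (weilChar_isPrimitive hr) (by simp [e]) fun u x => ?_)
  have hux : x * u = ((x.val * u.val : ℤ) : ZMod q) := by
    push_cast
    rw [ZMod.natCast_zmod_val, ZMod.natCast_zmod_val]
  rw [hux, weilChar_intCast, ← e_add, ← e_add, e_sq_div_congr hq (n := u.val + x.val) (by simp)]
  congr 1
  have hq0 : (q : ℝ) ≠ 0 := Nat.cast_ne_zero.2 (NeZero.ne q)
  field_simp
  push_cast
  ring

theorem isUnit_opFourier_of_even (hq : Even q) (hr : IsCoprime r q) :
    IsUnit (opFourier q r) :=
  (LinearMap.isUnit_iff_ker_eq_bot _).2 <| LinearMap.ker_eq_bot.2 <|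
    injective_of_fourier (weilChar_isPrimitive hr)
      (div_ne_zero (gaussS_neg_one_ne_zero_of_even hq hr) (by simp [NeZero.ne q]))
      (opFourier_apply_of_even hq)

/-- If `q` divides `2b²`, then the operators `U(n_c)` with `4 ∣ c` act trivially on functions that
live on the multiples of `b`: there the phase `r c x² / 2q` is an integer. -/
theorem opUpper_eq_self_of_even (hq : Even q) {b : ℕ} (hb : q ∣ 2 * b ^ 2)
    {c : ZMod (level q)} (hc : 4 ∣ c.val) {φ : ZMod q → ℂ} (hφ : ∀ x, φ x ≠ 0 → b ∣ x.val) :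
    opUpper q r c φ = φ := by
  ext x
  by_cases hx : φ x = 0
  · simp [opUpper, hx]
  · obtain ⟨y, hy⟩ := hφ x hx
    obtain ⟨k, hk⟩ := hb
    obtain ⟨d, hd⟩ := hc
    have hq0 : (q : ℝ) ≠ 0 := Nat.cast_ne_zero.2 (NeZero.ne q)
    have hk' : (2 * b ^ 2 : ℝ) = q * k := by exact_mod_cast hk
    have : (r * (c.val : ℝ) * (x.val : ℝ) ^ 2 / level q) = ((r * d * k * y ^ 2 : ℤ) : ℝ) := by
      rw [hy, hd, level_of_even hq]
      push_cast
      field_simp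
      linear_combination (2 * r * d * y ^ 2 : ℝ) * hk'
    change e (r * (c.val : ℝ) * (x.val : ℝ) ^ 2 / level q) * φ x = φ x
    rw [this, e_intCast, one_mul]

/-- The Fourier transform of a `b`-periodic function lives on the multiples of `b` if `b² ∣ q`. -/
theorem dvd_val_of_opFourier_ne_zero_of_even (hq : Even q) (hr : IsCoprime r q) {b : ℕ}
    (hb : b ^ 2 ∣ q) {φ : ZMod q → ℂ} (hφ : ∀ x, φ (x + b) = φ x) (x : ZMod q)
    (hx : opFourier q r φ x ≠ 0) : b ∣ x.val := by
  rw [opFourier_apply_of_even hq] at hx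
  have hS := right_ne_zero_of_mul hx
  -- The shift `y ↦ y + b` multiplies the sum by `χ(xb)`.
  have htr : ∑ y, φ y * weilChar q r (x * y) =
      weilChar q r (x * b) * ∑ y, φ y * weilChar q r (x * y) := by
    rw [Finset.mul_sum]
    refine (Fintype.sum_equiv (Equiv.addRight (b : ZMod q)) _ _ fun y => ?_).symm
    rw [Equiv.coe_addRight, hφ, mul_left_comm, ← AddChar.map_add_eq_mul, mul_add, add_comm]
  have h1 : weilChar q r (x * b) = 1 := (mul_eq_right₀ hS).1 htr.symm
  have hxb : x * b = 0 := by
    by_contra hne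
    have hu : IsUnit (r : ZMod q) := isUnit_intCast_of_isCoprime hr
    rw [weilChar, AddChar.mulShift_apply, ← AddChar.map_zero_eq_one (ZMod.stdAddChar (N := q))] at h1
    exact hne (hu.mul_right_eq_zero.1 (ZMod.injective_stdAddChar h1))
  rw [← ZMod.natCast_zmod_val x, ← Nat.cast_mul, ZMod.natCast_eq_zero_iff] at hxb
  have hb0 : 0 < b := Nat.pos_of_ne_zero fun h => NeZero.ne q (by simpa [h] using hb)
  have := hb.trans hxb
  rw [pow_two] at this
  exact Nat.dvd_of_mul_dvd_mul_right hb0 this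

/-- If `b² ∣ q ∣ 2b²` with `q` even, then the indicator function of the multiples of `b` is an
eigenfunction of all the operators `U_q(g)`. -/
theorem exists_eigenvalue_indicator_of_even (hq : Even q) (hr : IsCoprime r q) {b : ℕ}
    (hb : b ^ 2 ∣ q) (hb2 : q ∣ 2 * b ^ 2) {ψ : ZMod q → ℂ}
    (h1 : ∀ x, (b : ZMod q) ∣ x → ψ x = 1) (h0 : ∀ x, ¬ (b : ZMod q) ∣ x → ψ x = 0)
    {P : SL(2, ZMod (level q)) × Module.End ℂ (ZMod q → ℂ)} (hP : P ∈ weilGraph q r) :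
    ∃ μ : ℂ, P.2 ψ = μ • ψ := by
  have : NeZero (level q) := ⟨by rw [level_of_even hq]; exact mul_ne_zero two_ne_zero (NeZero.ne q)⟩
  have hbq : b ∣ q := (dvd_pow_self b two_ne_zero).trans hb
  have hcongr : ∀ {x y : ZMod q}, ((b : ZMod q) ∣ x ↔ (b : ZMod q) ∣ y) → ψ x = ψ y := by
    intro x y h
    by_cases hx : (b : ZMod q) ∣ x
    · rw [h1 x hx, h1 y (h.1 hx)]
    · rw [h0 x hx, h0 y (mt h.2 hx)]
  induction hP using Submonoid.closure_induction with
  | mem P hP =>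
    rw [weilGenerators, if_pos hq] at hP
    rcases hP with ⟨c, hc, rfl⟩ | ⟨c, hc, rfl⟩ | ⟨t, -, rfl⟩
    · refine ⟨1, ?_⟩
      rw [one_smul]
      exact opUpper_eq_self_of_even hq hb2 hc fun x hx =>
        (natCast_dvd_iff hbq x).1 (not_imp_comm.1 (h0 x) hx)
    · refine ⟨1, ?_⟩
      have h4 : 4 ∣ (-c).val := by
        rw [ZMod.neg_val]
        split_ifs
        · exact dvd_zero 4
        · refine Nat.dvd_sub ?_ hc
          rw [level_of_even hq]
          exact Nat.mul_dvd_mul_left 2 (even_iff_two_dvd.1 hq)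
      have hper : ∀ x, ψ (x + b) = ψ x := fun x => hcongr (dvd_add_left dvd_rfl)
      change Ring.inverse (opFourier q r) (opUpper q r (-c) (opFourier q r ψ)) = _
      rw [opUpper_eq_self_of_even hq hb2 h4 (dvd_val_of_opFourier_ne_zero_of_even hq hr hb hper),
        ← Module.End.mul_apply, Ring.inverse_mul_cancel _ (isUnit_opFourier_of_even hq hr),
        Module.End.one_apply, one_smul]
    · refine ⟨Lam q r t, funext fun x => ?_⟩
      have hu : IsUnit ((t : ZMod (level q)).val : ZMod q) := by
        rw [ZMod.natCast_val, ← ZMod.castHom_apply (h := dvd_level q)]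
        exact t.isUnit.map _
      change Lam q r t * ψ (((t : ZMod (level q)).val : ZMod q) * x) = Lam q r t * ψ x
      rw [hcongr (y := x) hu.dvd_mul_left]
  | one => exact ⟨1, by simp⟩
  | mul P Q _ _ hP hQ =>
    obtain ⟨μ, hμ⟩ := hP
    obtain ⟨ν, hν⟩ := hQ
    refine ⟨ν * μ, ?_⟩
    change P.2 (Q.2 ψ) = _
    rw [hν, map_smul, hμ, smul_smul]

end Even

/-- The eigenfunctions for a prime power `q`, localized on the multiples of `b`. -/
theorem exists_local_eigenfunction {p k q : ℕ} [NeZero q] (hp : p.Prime) (hq : q = p ^ k) {r : ℤ}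
    (hr : IsCoprime r p) {b : ℕ} (hb : b ^ 2 ∣ q) (A : Matrix (Fin 2) (Fin 2) (ZMod (level q))) :
    ∃ ψ : ZMod q → ℂ, ψ ≠ 0 ∧ (∀ x, ψ x ≠ 0 → b ∣ x.val) ∧
      ∀ g V, (g, V) ∈ weilGraph q r → (∃ x y : ZMod (level q), g.1 = x • 1 + y • A) →
        ∃ μ : ℂ, V ψ = μ • ψ := by
  have hrq : IsCoprime r q := by
    rw [hq, Nat.cast_pow]
    exact hr.pow_right
  rcases Nat.even_or_odd q with he | ho
  · have hp2 : p = 2 := by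
      rw [hq, Nat.even_pow] at he
      exact hp.even_iff.1 he.1
    subst hp2
    obtain ⟨j, -, hj⟩ := (Nat.dvd_prime_pow hp).1
      ((hq ▸ (dvd_pow_self b two_ne_zero).trans hb : b ∣ 2 ^ k))
    -- The exponent `k / 2` is rounded down, so that `4 ^ (k / 2)` is `q` or `q / 2`.
    have hjk : j ≤ k / 2 := by
      rw [hq, hj, ← pow_mul, Nat.pow_dvd_pow_iff_le_right (by norm_num)] at hb
      omega
    have hb1 : (2 ^ (k / 2)) ^ 2 ∣ q := by
      rw [hq, ← pow_mul]
      exact pow_dvd_pow 2 (by omega)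
    have hb2 : q ∣ 2 * (2 ^ (k / 2)) ^ 2 := by
      rw [hq, ← pow_mul, ← pow_succ']
      exact pow_dvd_pow 2 (by omega)
    classical
    refine ⟨fun x => if ((2 ^ (k / 2) : ℕ) : ZMod q) ∣ x then 1 else 0, fun h => ?_,
      fun x hx => ?_, fun g V hV _ => ?_⟩
    · simpa using congrFun h 0
    · have hx' : ((2 ^ (k / 2) : ℕ) : ZMod q) ∣ x := by
        by_contra h
        exact hx (if_neg h)
      rw [natCast_dvd_iff ((dvd_pow_self _ two_ne_zero).trans hb1)] at hx'
      exact (hj ▸ pow_dvd_pow 2 hjk).trans hx'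
    · exact exists_eigenvalue_indicator_of_even he hrq hb1 hb2 (fun x hx => if_pos hx)
        (fun x hx => if_neg hx) hV
  · exact exists_local_eigenfunction_of_odd ho hrq hb A

/-! ### Products over the primes -/

/-- The function on `ℤ/N` that corresponds to `⨂_p f_p`. -/
def tensorFun (N : ℕ) (f : (p : ℕ) → ZMod (ppart N p) → ℂ) (x : ZMod N) : ℂ :=
  ∏ p ∈ N.primeFactors, f p (x.val : ZMod (ppart N p))

/-- The isomorphism of the Chinese remainder theorem. -/
def crt (N : ℕ) [NeZero N] : ZMod N ≃+* ((p : N.primeFactors) → ZMod (ppart N p)) :=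
  ZMod.equivPi N (NeZero.ne N)

section Tensor

variable {N : ℕ} [NeZero N]

theorem crt_apply (x : ZMod N) (p : N.primeFactors) :
    crt N x p = (x.val : ZMod (ppart N p)) := by
  conv_lhs => rw [← ZMod.natCast_zmod_val x, map_natCast]
  rfl

theorem tensorFun_eq_prod_crt (f : (p : ℕ) → ZMod (ppart N p) → ℂ) (x : ZMod N) :
    tensorFun N f x = ∏ p : N.primeFactors, f p (crt N x p) := by
  simp_rw [crt_apply]
  exact (Finset.prod_coe_sort N.primeFactors
    (fun p => f p (x.val : ZMod (ppart N p)))).symm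

/-- `(⨂ W_p)(⨂ f_p) = ⨂ W_p f_p`: the Chinese remainder theorem turns the sum over `ℤ/N` into
the product of the sums over the `ℤ/p^k`. -/
theorem tensorOp_tensorFun (W : (p : ℕ) → Module.End ℂ (ZMod (ppart N p) → ℂ))
    (f : (p : ℕ) → ZMod (ppart N p) → ℂ) :
    tensorOp N W (tensorFun N f) = tensorFun N (fun p => W p (f p)) := by
  ext x
  have hW : ∀ p, W p (f p) (x.val : ZMod (ppart N p)) =
      ∑ j, LinearMap.toMatrix' (W p) (x.val : ZMod (ppart N p)) j * f p j := fun p => by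
    rw [← LinearMap.toMatrix'_mulVec]
    rfl
  calc tensorOp N W (tensorFun N f) x
      = ∑ y, tensorFun N (fun p j =>
          LinearMap.toMatrix' (W p) (x.val : ZMod (ppart N p)) j * f p j) y := by
        rw [tensorOp, Matrix.toLin'_apply]
        refine Finset.sum_congr rfl fun y _ => ?_
        exact (Finset.prod_mul_distrib (s := N.primeFactors)
          (f := fun p => LinearMap.toMatrix' (W p) (x.val : ZMod (ppart N p)) y.val)
          (g := fun p => f p y.val)).symm
    _ = ∑ z : (p : N.primeFactors) → ZMod (ppart N p), ∏ p : N.primeFactors,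
          LinearMap.toMatrix' (W p) (x.val : ZMod (ppart N p)) (z p) * f p (z p) :=
        Fintype.sum_equiv (crt N).toEquiv _ _ fun y => tensorFun_eq_prod_crt _ y
    _ = tensorFun N (fun p => W p (f p)) x := by
        rw [tensorFun_eq_prod_crt]
        simp_rw [crt_apply, hW]
        rw [Finset.prod_univ_sum, Fintype.piFinset_univ]

theorem tensorFun_ne_zero {f : (p : ℕ) → ZMod (ppart N p) → ℂ}
    (hf : ∀ p ∈ N.primeFactors, f p ≠ 0) : tensorFun N f ≠ 0 := by
  have h : ∀ p : N.primeFactors, ∃ x, f p x ≠ 0 := fun p => Function.ne_iff.1 (hf p p.2)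
  choose z hz using h
  refine Function.ne_iff.2 ⟨(crt N).symm z, ?_⟩
  rw [tensorFun_eq_prod_crt, RingEquiv.apply_symm_apply]
  exact Finset.prod_ne_zero_iff.2 fun p _ => hz p

/-- Products of local joint eigenfunctions are Hecke eigenfunctions, since the components of
`xI + yA` have the same shape. -/
theorem isHeckeEigenfunction_tensorFun {r : ℕ → ℤ} {A : SL(2, ℤ)}
    {f : (p : ℕ) → ZMod (ppart N p) → ℂ} (hf : ∀ p ∈ N.primeFactors, f p ≠ 0)
    (hev : ∀ p ∈ N.primeFactors, ∀ g V, (g, V) ∈ weilGraph (ppart N p) (r p) →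
      (∃ x y : ZMod (level (ppart N p)), g.1 = x • 1 + y • A.1.map (fun n : ℤ => (n : ZMod _))) →
        ∃ μ : ℂ, V (f p) = μ • f p) :
    IsHeckeEigenfunction N r A (tensorFun N f) := by
  refine ⟨tensorFun_ne_zero hf, ?_⟩
  rintro _ ⟨g, x, y, hg, W, hW, rfl⟩
  have h : ∀ p : ℕ, ∃ μ : ℂ, p ∈ N.primeFactors → W p (f p) = μ • f p := by
    intro p
    by_cases hp : p ∈ N.primeFactors
    · obtain ⟨μ, hμ⟩ := hev p hp _ _ (hW p hp)
        ⟨ZMod.castHom (level_ppart_dvd N p) _ x, ZMod.castHom (level_ppart_dvd N p) _ y, by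
          change g.1.map (ZMod.castHom (level_ppart_dvd N p) _) = _
          rw [hg]
          ext i j
          by_cases hij : i = j <;> simp [-ZMod.castHom_apply, hij]⟩
      exact ⟨μ, fun _ => hμ⟩
    · exact ⟨0, fun h => absurd h hp⟩
  choose μ hμ using h
  refine ⟨∏ p ∈ N.primeFactors, μ p, ?_⟩
  rw [tensorOp_tensorFun]
  ext x
  simp only [tensorFun, Pi.smul_apply, smul_eq_mul, ← Finset.prod_mul_distrib]
  refine Finset.prod_congr rfl fun p hp => ?_
  rw [hμ p hp]
  rfl

/-! ### Supremum norms of localized functions -/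

theorem card_filter_dvd_val_mul_le {b : ℕ} (hb : b ∣ N) :
    (Finset.univ.filter fun x : ZMod N => b ∣ x.val).card * b ≤ N := by
  have hle : (Finset.univ.filter fun x : ZMod N => b ∣ x.val).card ≤ (Finset.range (N / b)).card := by
    refine Finset.card_le_card_of_injOn (fun x => x.val / b) (fun x _ => ?_) fun x hx y hy h => ?_
    · exact Finset.mem_coe.2 (Finset.mem_range.2 (Nat.div_lt_div_of_lt_of_dvd hb (ZMod.val_lt x)))
    · have hx' := (Finset.mem_filter.1 hx).2
      have hy' := (Finset.mem_filter.1 hy).2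
      refine ZMod.val_injective N ?_
      rw [← Nat.div_mul_cancel hx', ← Nat.div_mul_cancel hy']
      exact congrArg (· * b) h
  rw [Finset.card_range] at hle
  exact (Nat.mul_le_mul_right b hle).trans (Nat.div_mul_le_self N b)

/-- A normalized function that lives on the multiples of `b` is large: its `L²` norm `1` is the
average over `N` points of a function that vanishes outside `N / b` of them. -/
theorem sqrt_le_supNorm {b : ℕ} (hb : b ∣ N) {ψ : ZMod N → ℂ} (hψ : ∀ x, ψ x ≠ 0 → b ∣ x.val)
    (hnorm : l2norm ψ = 1) : (b : ℝ) ^ (1 / 2 : ℝ) ≤ supNorm ψ := by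
  have hN : (0 : ℝ) < N := Nat.cast_pos.2 (NeZero.pos N)
  have hle : ∀ x, ‖ψ x‖ ≤ supNorm ψ := fun x => 
    le_ciSup (f := fun x => ‖ψ x‖) (Set.finite_range _).bddAbove x
  have h0 : 0 ≤ supNorm ψ := (norm_nonneg _).trans (hle 0)
  have hsum : ∑ x, ‖ψ x‖ ^ 2 = N := by
    rw [l2norm, Real.sqrt_eq_one] at hnorm
    field_simp at hnorm
    exact hnorm
  have hbound : ∑ x, ‖ψ x‖ ^ 2 ≤
      (Finset.univ.filter fun x : ZMod N => b ∣ x.val).card * supNorm ψ ^ 2 := by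
    rw [← nsmul_eq_mul, ← Finset.sum_const, Finset.sum_filter]
    refine Finset.sum_le_sum fun x _ => ?_
    split_ifs with hx
    · exact pow_le_pow_left₀ (norm_nonneg _) (hle x) 2
    · simp [not_imp_comm.1 (hψ x) hx]
  have hcard : ((Finset.univ.filter fun x : ZMod N => b ∣ x.val).card * b : ℝ) ≤ N := by
    exact_mod_cast card_filter_dvd_val_mul_le hb
  rw [← Real.sqrt_eq_rpow]
  refine Real.sqrt_le_iff.2 ⟨h0, ?_⟩
  rw [hsum] at hbound
  refine le_of_mul_le_mul_left ?_ hN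
  calc (N : ℝ) * b ≤ _ := mul_le_mul_of_nonneg_right hbound (Nat.cast_nonneg b)
    _ = ((Finset.univ.filter fun x : ZMod N => b ∣ x.val).card * b : ℝ) * supNorm ψ ^ 2 := by ring
    _ ≤ N * supNorm ψ ^ 2 := mul_le_mul_of_nonneg_right hcard (sq_nonneg _)

theorem l2norm_smul (c : ℂ) (ψ : ZMod N → ℂ) : l2norm (c • ψ) = ‖c‖ * l2norm ψ := by
  simp only [l2norm, Pi.smul_apply, smul_eq_mul, norm_mul, mul_pow, ← Finset.mul_sum]
  rw [mul_left_comm, Real.sqrt_mul (sq_nonneg _), Real.sqrt_sq (norm_nonneg c)]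

theorem l2norm_ne_zero {ψ : ZMod N → ℂ} (hψ : ψ ≠ 0) : l2norm ψ ≠ 0 := by
  obtain ⟨x, hx⟩ := Function.ne_iff.1 hψ
  have hN : (0 : ℝ) < N := Nat.cast_pos.2 (NeZero.pos N)
  refine (Real.sqrt_pos.2 (mul_pos (by positivity) ?_)).ne'
  exact Finset.sum_pos' (fun y _ => sq_nonneg _)
    ⟨x, Finset.mem_univ x, pow_pos (norm_pos_iff.2 hx) 2⟩

theorem IsHeckeEigenfunction.smul {r : ℕ → ℤ} {A : SL(2, ℤ)} {ψ : ZMod N → ℂ}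
    (h : IsHeckeEigenfunction N r A ψ) {c : ℂ} (hc : c ≠ 0) :
    IsHeckeEigenfunction N r A (c • ψ) := by
  refine ⟨smul_ne_zero hc h.1, fun V hV => ?_⟩
  obtain ⟨μ, hμ⟩ := h.2 V hV
  exact ⟨μ, by rw [map_smul, hμ, smul_comm]⟩

/-- For every `b` with `b² ∣ N` there is a Hecke eigenfunction of large supremum norm. The local
factors live on the multiples of the `p`-parts of `b`, so that the product lives on the multiples
of `b`. -/
theorem exists_isHeckeEigenfunction_sqrt_le_supNorm {b : ℕ} (hb : b ^ 2 ∣ N) (A : SL(2, ℤ))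
    {r : ℕ → ℤ} (hr : ∀ p ∈ N.primeFactors, IsCoprime (r p) (p : ℤ)) :
    ∃ ψ : ZMod N → ℂ, IsHeckeEigenfunction N r A ψ ∧ l2norm ψ = 1 ∧
      (b : ℝ) ^ (1 / 2 : ℝ) ≤ supNorm ψ := by
  have hbN : b ∣ N := (dvd_pow_self b two_ne_zero).trans hb
  have hb0 : b ≠ 0 := fun h => NeZero.ne N (by simpa [h] using hb)
  have hsq : ∀ p, ppart b p ^ 2 ∣ ppart N p := fun p => by
    rw [ppart, ppart, ← pow_mul]
    refine pow_dvd_pow p ?_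
    have := (Nat.factorization_le_iff_dvd (pow_ne_zero 2 hb0) (NeZero.ne N)).2 hb p
    simpa [mul_comm] using this
  have hloc : ∀ p : ℕ, ∃ ψ : ZMod (ppart N p) → ℂ, p ∈ N.primeFactors → ψ ≠ 0 ∧
      (∀ x, ψ x ≠ 0 → ppart b p ∣ x.val) ∧
      ∀ g V, (g, V) ∈ weilGraph (ppart N p) (r p) →
        (∃ x y : ZMod (level (ppart N p)), g.1 = x • 1 + y • A.1.map (fun n : ℤ => (n : ZMod _))) →
        ∃ μ : ℂ, V ψ = μ • ψ := by
    intro p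
    by_cases hp : p ∈ N.primeFactors
    · obtain ⟨ψ, hψ⟩ := exists_local_eigenfunction (Nat.prime_of_mem_primeFactors hp)
        (q := ppart N p) rfl (hr p hp) (hsq p) (A.1.map (fun n : ℤ => (n : ZMod _)))
      exact ⟨ψ, fun _ => hψ⟩
    · exact ⟨0, fun h => absurd h hp⟩
  choose f hf using hloc
  have hH : IsHeckeEigenfunction N r A (tensorFun N f) :=
    isHeckeEigenfunction_tensorFun (fun p hp => (hf p hp).1) (fun p hp => (hf p hp).2.2)
  have hsupp : ∀ x, tensorFun N f x ≠ 0 → b ∣ x.val := by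
    intro x hx
    rw [← Nat.prod_factorization_pow_eq_self hb0]
    refine Finset.prod_dvd_of_isRelPrime ?_ fun p hp => ?_
    · intro p hp p' hp' hne
      exact Nat.coprime_iff_isRelPrime.1 ((Nat.coprime_primes (Nat.prime_of_mem_primeFactors hp)
        (Nat.prime_of_mem_primeFactors hp')).2 hne |>.pow _ _)
    · have hpN : p ∈ N.primeFactors := Nat.primeFactors_mono hbN (NeZero.ne N) hp
      have := (hf p hpN).2.1 _ (Finset.prod_ne_zero_iff.1 hx p hpN)
      rw [ZMod.val_natCast, Nat.dvd_mod_iff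
        ((dvd_pow_self _ two_ne_zero).trans (hsq p))] at this
      exact this
  have hl := l2norm_ne_zero hH.1
  have hc : (((l2norm (tensorFun N f))⁻¹ : ℝ) : ℂ) ≠ 0 :=
    Complex.ofReal_ne_zero.2 (inv_ne_zero hl)
  have hnorm : l2norm ((((l2norm (tensorFun N f))⁻¹ : ℝ) : ℂ) • tensorFun N f) = 1 := by
    rw [l2norm_smul, Complex.norm_real, norm_inv,
      Real.norm_of_nonneg (show 0 ≤ l2norm _ from Real.sqrt_nonneg _), inv_mul_cancel₀ hl]
  exact ⟨_, hH.smul hc, hnorm,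
    sqrt_le_supNorm hbN (fun x hx => hsupp x (right_ne_zero_of_mul hx)) hnorm⟩

end Tensor

end CatMap

end

theorem mainTheorem2 :
    (∀ (N a b : ℕ) [NeZero N] (A : Matrix.SpecialLinearGroup (Fin 2) ℤ) (r : ℕ → ℤ),
      CatMap.IsAdmissible N A →
      (∀ p ∈ N.primeFactors, IsCoprime (r p) (p : ℤ)) →
      ((N = a * b ^ 2 ∧ Odd b) ∨ N = 2 * a * b ^ 2) →
      ∃ ψ : ZMod N → ℂ, CatMap.IsHeckeEigenfunction N r A ψ ∧ CatMap.l2norm ψ = 1 ∧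
        (b : ℝ) ^ (1 / 2 : ℝ) ≤ CatMap.supNorm ψ) ∧
    (∃ C : ℝ, 0 < C ∧
      ∀ (N a : ℕ) [NeZero N] (A : Matrix.SpecialLinearGroup (Fin 2) ℤ) (r : ℕ → ℤ),
        CatMap.IsAdmissible N A →
        (∀ p ∈ N.primeFactors, IsCoprime (r p) (p : ℤ)) →
        N = a ^ 2 →
        ∃ ψ : ZMod N → ℂ, CatMap.IsHeckeEigenfunction N r A ψ ∧ CatMap.l2norm ψ = 1 ∧
          C * (N : ℝ) ^ (1 / 4 : ℝ) ≤ CatMap.supNorm ψ) := by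
  refine ⟨fun N a b _ A r _ hr h => ?_, 1, one_pos, fun N a _ A r _ hr h => ?_⟩
  · refine CatMap.exists_isHeckeEigenfunction_sqrt_le_supNorm ?_ A hr
    rcases h with ⟨h, -⟩ | h <;> exact ⟨_, h.trans (mul_comm _ _)⟩
  · have hrpow : 1 * (N : ℝ) ^ (1 / 4 : ℝ) = (a : ℝ) ^ (1 / 2 : ℝ) := by
      rw [one_mul, h, Nat.cast_pow, ← Real.rpow_natCast, ← Real.rpow_mul (Nat.cast_nonneg a)]
      norm_num
    rw [hrpow]
    exact CatMap.exists_isHeckeEigenfunction_sqrt_le_supNorm (dvd_of_eq h.symm) A hr
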